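/- Let $k$ be an infinite field, let $S=k[x_1,\ldots,x_n]$ with the standard grading, and for $1\le r\le n-1$ let $S(r)=k[x_1,\ldots,x_r]$, with maximal homogeneous ideal $\mathfrak m(r)=(x_1,\ldots,x_r)$. Let $\Pi_r:S\to S(r)$ be the $k$-algebra map with $x_i\mapsto x_i$ for $i\le r$ and $x_i\mapsto 0$ for $i>r$. For a monomial $w=x_1^{e_1}\cdots x_n^{e_n}$ put $\Phi_r(w)=x_1^{e_1}\cdots x_r^{e_r}$; for a monomial ideal $J\subset S$ let $\Phi_r(J)$ be the ideal of $S$ generated by the $\Phi_r(w)$, where $w$ runs over the minimal monomial generators of $J$, and let $\overline{\Phi_r}(J)=\Pi_r(\Phi_r(J))\subset S(r)$. For an ideal $I\subset S$ let $\mathrm{in}(I)$ be the ideal generated by the initial monomials of the nonzero elements of $I$ with respect to the graded reverse lexicographic order with $x_1>\cdots>x_n$. The generic initial ideal $\mathrm{gin}(I)$ of a homogeneous ideal $I$ is the common value of $\mathrm{in}(\alpha(I))$ for all $\alpha$ in a suitable nonempty Zariski open subset of $GL_n(k)$, which acts on $S$ by linear changes of coordinates. **Theorem.** Let $P$ be a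 homogeneous prime ideal of $S$ and let $J=\mathrm{gin}(P)$. Assume that for some $1\le r\le n-1$ there is a monomial $u\in \Pi_r(J):\mathfrak m(r)$ with $u\notin\Pi_r(J)$ and $$\overline{\Phi_r}(J)=\Pi_r(J)+(u).$$ Call a monomial $v$ an extra generator of $J$ if $J$ is generated by $J\cap k[x_1,\ldots,x_r]$ and $v$, and $v$ does not lie in the ideal of $S$ generated by $J\cap k[x_1,\ldots,x_r]$. Then: 1. Either $u=1$ and $(x_1,\ldots,x_r)\subset J$, or $J$ has an extra generator $v$. 2. If $u\neq 1$, then every extra generator is of the form $v=u\,x_{r+1}^e$ for some $e>0$. 3. If $u\neq 1$, then $J$ is generated by monomials in $k[x_1,\ldots,x_{r+1}]$. -/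

import Mathlib

open MvPolynomial

attribute [local instance] MvPolynomial.gradedAlgebra

noncomputable section

theorem sum_lt_succ {n : ℕ} (a : Fin n →₀ ℕ) (i : Fin n) :
    ∑ j : Fin n with j.val < i.val + 1, a j = ∑ j : Fin n with j.val < i.val, a j + a i := by
  have : (Finset.univ.filter fun j : Fin n => j.val < i.val + 1) =
      insert i (Finset.univ.filter fun j : Fin n => j.val < i.val) := by
    ext j
    simp [Fin.ext_iff]
    omega
  rw [this, Finset.sum_insert (by simp), add_comm]

/-- The vector `(a₁ + ⋯ + aₙ, a₁ + ⋯ + aₙ₋₁, …, a₁)` attached to an exponent vector `a`. -/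
def revPartialSums (n : ℕ) : (Fin n →₀ ℕ) →+ Lex (Fin n → ℕ) where
  toFun a := toLex fun i => ∑ j : Fin n with j.val < n - i.val, a j
  map_zero' := by
    apply ofLex.injective
    funext i
    change ∑ j : Fin n with j.val < n - i.val, (0 : Fin n →₀ ℕ) j = 0
    simp
  map_add' a b := by
    apply ofLex.injective
    funext i
    change ∑ j : Fin n with j.val < n - i.val, (a + b) j =
      ∑ j : Fin n with j.val < n - i.val, a j + ∑ j : Fin n with j.val < n - i.val, b j
    simp [Finset.sum_add_distrib]

theorem revPartialSums_injective (n : ℕ) : Function.Injective (revPartialSums n) := by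
  intro a b h
  have h1 : ∀ m ≤ n, ∑ j : Fin n with j.val < m, a j = ∑ j : Fin n with j.val < m, b j := by
    intro m hm
    rcases Nat.eq_zero_or_pos m with rfl | hm0
    · simp
    have h2 : ∑ j : Fin n with j.val < n - (n - m), a j =
        ∑ j : Fin n with j.val < n - (n - m), b j :=
      congrFun (congrArg ofLex h) ⟨n - m, by omega⟩
    rwa [Nat.sub_sub_self hm] at h2
  ext i
  have h2 := h1 (i.val + 1) i.isLt
  rw [sum_lt_succ, sum_lt_succ, h1 i.val i.isLt.le] at h2
  exact Nat.add_left_cancel h2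

/-- The graded reverse lexicographic order on the monomials in `n` variables, with
`x₁ > x₂ > ⋯ > xₙ`, obtained by comparing `(a₁ + ⋯ + aₙ, a₁ + ⋯ + aₙ₋₁, …, a₁)`
lexicographically; see `degRevLex_lt_iff` for the usual description. -/
def degRevLex (n : ℕ) : MonomialOrder (Fin n) where
  syn := AddMonoidHom.mrange (revPartialSums n)
  addCommMonoidSyn := inferInstance
  linearOrderSyn := inferInstance
  isOrderedAddMonoid_syn := inferInstance
  wellFoundedLT_syn := inferInstance
  toSyn := AddEquiv.ofBijective (revPartialSums n).mrangeRestrict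
    ⟨fun _ _ h => revPartialSums_injective n (congrArg Subtype.val h),
      (revPartialSums n).mrangeRestrict_surjective⟩
  toSyn_monotone := by
    intro a b h
    change revPartialSums n a ≤ revPartialSums n b
    apply Pi.toLex_monotone
    intro i
    exact Finset.sum_le_sum fun j _ => h j

open scoped MonomialOrder in
/-- `x^a < x^b` iff `deg a < deg b`, or the degrees agree and at the last index where the exponents
differ `a` has the larger one. -/
theorem degRevLex_lt_iff {n : ℕ} (a b : Fin n →₀ ℕ) :
    a ≺[degRevLex n] b ↔ a.degree < b.degree ∨
      (a.degree = b.degree ∧ ∃ i, b i < a i ∧ ∀ j, i < j → a j = b j) := by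
  have hdeg : ∀ c : Fin n →₀ ℕ, ∑ j : Fin n with j.val < n, c j = c.degree := by
    intro c
    simp [Finsupp.degree_eq_sum]
  have key : a ≺[degRevLex n] b ↔ ∃ i : Fin n,
      (∀ j : Fin n, j < i → ∑ l : Fin n with l.val < n - j.val, a l =
        ∑ l : Fin n with l.val < n - j.val, b l) ∧
      ∑ l : Fin n with l.val < n - i.val, a l < ∑ l : Fin n with l.val < n - i.val, b l := Iff.rfl
  rw [key]
  constructor
  · rintro ⟨i, hi, hlt⟩
    rcases Nat.eq_zero_or_pos i.val with h0 | h0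
    · left
      rw [h0, Nat.sub_zero, hdeg, hdeg] at hlt
      exact hlt
    · right
      have hi' : ∀ m, n - i.val < m → m ≤ n → ∑ l : Fin n with l.val < m, a l =
          ∑ l : Fin n with l.val < m, b l := by
        intro m h1 h2
        have := hi ⟨n - m, by omega⟩ (by rw [Fin.lt_def]; simp only; omega)
        simpa only [Nat.sub_sub_self h2] using this
      refine ⟨?_, ⟨n - i.val, by omega⟩, ?_, ?_⟩
      · rw [← hdeg, ← hdeg]
        exact hi' n (by omega) le_rfl
      · have h2 := hi' (n - i.val + 1) (by omega) (by omega)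
        have ha := sum_lt_succ a ⟨n - i.val, by omega⟩
        have hb := sum_lt_succ b ⟨n - i.val, by omega⟩
        simp only at ha hb
        omega
      · intro j hj
        rw [Fin.lt_def] at hj
        simp only at hj
        have h2 := hi' (j.val + 1) (by omega) (by omega)
        have h3 := hi' j.val (by omega) (by omega)
        rw [sum_lt_succ, sum_lt_succ] at h2
        omega
  · rintro (h | ⟨hd, i, hi, hj⟩)
    · have hn : 0 < n := by
        rcases Nat.eq_zero_or_pos n with rfl | h0
        · simp [Subsingleton.elim a b] at h
        · exact h0
      refine ⟨⟨0, hn⟩, fun j hj => absurd hj (by simp [Fin.lt_def]), ?_⟩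
      simp only [Nat.sub_zero]
      rw [hdeg, hdeg]
      exact h
    · have hs : ∀ t m, m + t = n → i.val < m → ∑ l : Fin n with l.val < m, a l =
          ∑ l : Fin n with l.val < m, b l := by
        intro t
        induction t with
        | zero =>
          intro m hm _
          obtain rfl : m = n := by omega
          rw [hdeg, hdeg, hd]
        | succ t ih =>
          intro m hm him
          have h2 := ih (m + 1) (by omega) (by omega)
          have ha := sum_lt_succ a ⟨m, by omega⟩
          have hb := sum_lt_succ b ⟨m, by omega⟩
          have hm' := hj ⟨m, by omega⟩ (by rw [Fin.lt_def]; exact him)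
          simp only at ha hb
          omega
      have h1 := hs (n - (i.val + 1)) (i.val + 1) (by omega) (by omega)
      rw [sum_lt_succ, sum_lt_succ] at h1
      have hi0 : 0 < i.val := by
        rcases Nat.eq_zero_or_pos i.val with h0 | h0
        · rw [h0] at h1
          simp at h1
          omega
        · exact h0
      refine ⟨⟨n - i.val, by omega⟩, ?_, ?_⟩
      · intro j hj'
        rw [Fin.lt_def] at hj'
        simp only at hj'
        exact hs j.val (n - j.val) (by omega) (by omega)
      · simp only [Nat.sub_sub_self i.isLt.le]
        omega

/-- The initial ideal of `I`: generated by the leading monomials of the nonzero elements of `I`. -/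
def initialIdeal {k : Type*} [Field k] {n : ℕ} (m : MonomialOrder (Fin n))
    (I : Ideal (MvPolynomial (Fin n) k)) : Ideal (MvPolynomial (Fin n) k) :=
  Ideal.span {g | ∃ f ∈ I, f ≠ 0 ∧ g = monomial (m.degree f) 1}

/-- The linear change of coordinates `x_j ↦ ∑ i, α i j * x_i` given by a matrix `α ∈ GLₙ(k)`. -/
def linearSubst {k : Type*} [Field k] {n : ℕ} (α : GL (Fin n) k) :
    MvPolynomial (Fin n) k →ₐ[k] MvPolynomial (Fin n) k :=
  aeval fun j => ∑ i, C (α.val i j) * X i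

/-- Zariski open subsets of `GLₙ(k)`, as a subspace of the affine space of `n × n` matrices. -/
def IsZariskiOpen {k : Type*} [Field k] {n : ℕ} (U : Set (GL (Fin n) k)) : Prop :=
  ∃ F : Set (MvPolynomial (Fin n × Fin n) k),
    U = {α | ∃ f ∈ F, eval (fun p => α.val p.1 p.2) f ≠ 0}

/-- Over an infinite field, two nonempty Zariski open subsets of `GLₙ(k)` meet. -/
theorem IsZariskiOpen.inter_nonempty {k : Type*} [Field k] [Infinite k] {n : ℕ}
    {U V : Set (GL (Fin n) k)} (hU : IsZariskiOpen U) (hV : IsZariskiOpen V)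
    (hU' : U.Nonempty) (hV' : V.Nonempty) : (U ∩ V).Nonempty := by
  obtain ⟨F, rfl⟩ := hU
  obtain ⟨G, rfl⟩ := hV
  obtain ⟨α, f, hf, hα⟩ := hU'
  obtain ⟨β, g, hg, hβ⟩ := hV'
  let d : MvPolynomial (Fin n × Fin n) k := (Matrix.of fun i j => X (i, j)).det
  have hd : ∀ M : Matrix (Fin n) (Fin n) k, eval (fun p => M p.1 p.2) d = M.det := by
    intro M
    rw [RingHom.map_det]
    congr 1
    ext i j
    simp
  have hne : f * g * d ≠ 0 := by
    refine mul_ne_zero (mul_ne_zero ?_ ?_) ?_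
    · rintro rfl
      simp at hα
    · rintro rfl
      simp at hβ
    · intro h0
      have := hd 1
      rw [h0] at this
      simp at this
  obtain ⟨x, hx⟩ : ∃ x, eval x (f * g * d) ≠ 0 := by
    by_contra! h
    exact hne (MvPolynomial.funext fun x => by simpa using h x)
  let M : Matrix (Fin n) (Fin n) k := Matrix.of fun i j => x (i, j)
  have hM : eval (fun p => M p.1 p.2) (f * g * d) ≠ 0 := hx
  simp only [map_mul, hd] at hM
  have hM' := mul_ne_zero_iff.1 hM
  have hM'' := mul_ne_zero_iff.1 hM'.1
  exact ⟨Matrix.GeneralLinearGroup.mkOfDetNeZero M hM'.2, ⟨f, hf, hM''.1⟩, ⟨g, hg, hM''.2⟩⟩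

/-- `J` is the generic initial ideal of `I` for the graded reverse lexicographic order: the
common value of `in(α(I))` for all `α` in a nonempty Zariski open subset of `GLₙ(k)`. -/
def IsGenericInitialIdeal {k : Type*} [Field k] {n : ℕ}
    (I J : Ideal (MvPolynomial (Fin n) k)) : Prop :=
  ∃ U : Set (GL (Fin n) k), IsZariskiOpen U ∧ U.Nonempty ∧
    ∀ α ∈ U, initialIdeal (degRevLex n) (I.map (linearSubst α)) = J

/-- Over an infinite field there is at most one generic initial ideal. -/
theorem IsGenericInitialIdeal.unique {k : Type*} [Field k] [Infinite k] {n : ℕ}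
    {I J J' : Ideal (MvPolynomial (Fin n) k)}
    (h : IsGenericInitialIdeal I J) (h' : IsGenericInitialIdeal I J') : J = J' := by
  obtain ⟨U, hU, hU0, hUJ⟩ := h
  obtain ⟨V, hV, hV0, hVJ⟩ := h'
  obtain ⟨α, hαU, hαV⟩ := hU.inter_nonempty hV hU0 hV0
  rw [← hUJ α hαU, hVJ α hαV]

/-- The exponents of the minimal monomial generators of a monomial ideal: the monomials in `J`
that are minimal for divisibility. -/
def minimalMonomials {k : Type*} [Field k] {n : ℕ} (J : Ideal (MvPolynomial (Fin n) k)) :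
    Set (Fin n →₀ ℕ) :=
  {a | Minimal (fun b => monomial b (1 : k) ∈ J) a}

/-- The projection `Π_r : k[x₁,…,xₙ] → k[x₁,…,x_r]` killing `x_{r+1},…,xₙ`. -/
def projVars (k : Type*) [Field k] (n r : ℕ) :
    MvPolynomial (Fin n) k →ₐ[k] MvPolynomial (Fin r) k :=
  aeval fun i => if h : i.val < r then X ⟨i.val, h⟩ else 0

/-- `Φ_r(J)` for a monomial ideal `J`: generated by the monomials `Φ_r(u)`, obtained by deleting
all factors `x_{r+1},…,xₙ` from the minimal monomial generators `u` of `J`. -/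
def Phi {k : Type*} [Field k] {n : ℕ} (r : ℕ) (J : Ideal (MvPolynomial (Fin n) k)) :
    Ideal (MvPolynomial (Fin n) k) :=
  Ideal.span ((fun a => monomial (a.filter fun i => i.val < r) 1) '' minimalMonomials J)

/-- The ideal `Π_r(Φ_r(J))` of `k[x₁,…,x_r]`. -/
def PhiBar {k : Type*} [Field k] {n : ℕ} (r : ℕ) (J : Ideal (MvPolynomial (Fin n) k)) :
    Ideal (MvPolynomial (Fin r) k) :=
  (Phi r J).map (projVars k n r)

/-- The maximal homogeneous ideal `(x₁,…,x_r)` of `k[x₁,…,x_r]`. -/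
def maxHomogeneousIdeal (k : Type*) [Field k] (r : ℕ) : Ideal (MvPolynomial (Fin r) k) :=
  Ideal.span (Set.range X)

/-- The ideal of `k[x₁,…,xₙ]` generated by `J ∩ k[x₁,…,x_r]`. -/
def contractExtend {k : Type*} [Field k] {n : ℕ} (r : ℕ) (J : Ideal (MvPolynomial (Fin n) k)) :
    Ideal (MvPolynomial (Fin n) k) :=
  Ideal.span {f | f ∈ J ∧ f ∈ supported k {i : Fin n | i.val < r}}

/-- The monomial `x^b` is the one extra generator of `J` over `J ∩ k[x₁,…,x_r]`: together they
generate `J`, and `J ∩ k[x₁,…,x_r]` alone does not generate `x^b`. -/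
def IsExtraGenerator {k : Type*} [Field k] {n : ℕ} (r : ℕ) (J : Ideal (MvPolynomial (Fin n) k))
    (b : Fin n →₀ ℕ) : Prop :=
  J = contractExtend r J ⊔ Ideal.span {monomial b 1} ∧ monomial b 1 ∉ contractExtend r J

end

/-! ### Low and high variables: grading polynomials by their part in the first `r` variables. -/

section Low

variable {n : ℕ}

/-! Call `x_1, …, x_r` low and the other variables high. Let `M` be the set of exponents of
monomials in `J`, and let `u = x^s`. The hypotheses on `u` say that `x^s` is a socle monomial for
`M`, and that a monomial of `J` whose low part is not in `J` has low part exactly `x^s`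
(`IsSocleShape`).

Take a coordinate change `α` in the open set defining `J`, put `Q = α(P)`, and consider the `f ∈ Q`
having no term with low part in `M`. If such an `f` is nonzero, its leading monomial is `x^s` times
that of its `x^s`-coefficient `g`, a polynomial in the high variables (`degree_eq_add`). For two
such elements, `g f' - g' f` is again of this kind and has `x^s`-coefficient zero, so `g f' = g' f`.
If `u ≠ 1`, then `Q` contains no nonzero polynomial in the high variables. Since `Q` is prime,
common factors of `f` and `g` can be divided out of `f`; once they are coprime, `g` divides every
`g'` (`exists_generator`). Hence `x^s in(g)` lies in `J` and divides every monomial of `J` whose low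
part is not in `J`: one extra generator suffices.

It remains to see that `in(g)` is a power of `x_{r+1}`. A generic change of coordinates that fixes
the low variables and preserves the polynomials in the high ones stays in the open set, so it does
not change `J`, but it turns `in(g)` into a power `x_{r+1}^E` (`exists_rowShear_degree_eq_single`).
Thus `x^s x_{r+1}^E` is in `J` and is divisible by `x^s in(g)`. -/

/-- The part of an exponent vector that lives in the first `r` variables. -/
def lowPart (r : ℕ) (c : Fin n →₀ ℕ) : Fin n →₀ ℕ := c.filter fun i => i.val < r

theorem lowPart_apply (r : ℕ) (c : Fin n →₀ ℕ) (i : Fin n) :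
    lowPart r c i = if i.val < r then c i else 0 := rfl

theorem lowPart_add (r : ℕ) (c d : Fin n →₀ ℕ) :
    lowPart r (c + d) = lowPart r c + lowPart r d := Finsupp.filter_add

theorem lowPart_zero (r : ℕ) : lowPart r (0 : Fin n →₀ ℕ) = 0 := Finsupp.filter_zero _

theorem lowPart_le (r : ℕ) (c : Fin n →₀ ℕ) : lowPart r c ≤ c := by
  intro i
  rw [lowPart_apply]
  split_ifs <;> simp

theorem lowPart_mono (r : ℕ) {c d : Fin n →₀ ℕ} (h : c ≤ d) : lowPart r c ≤ lowPart r d := by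
  intro i
  rw [lowPart_apply, lowPart_apply]
  split_ifs
  · exact h i
  · exact le_rfl

theorem lowPart_lowPart (r : ℕ) (c : Fin n →₀ ℕ) : lowPart r (lowPart r c) = lowPart r c := by
  ext i
  simp only [lowPart_apply]
  split_ifs <;> rfl

theorem lowPart_eq_self_iff {r : ℕ} {c : Fin n →₀ ℕ} :
    lowPart r c = c ↔ ∀ i : Fin n, r ≤ i.val → c i = 0 := by
  constructor
  · intro h i hi
    rw [← h, lowPart_apply, if_neg (by omega)]
  · intro h
    ext i
    rw [lowPart_apply]
    split_ifs with hi
    · rfl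
    · exact (h i (by omega)).symm

theorem lowPart_eq_zero_iff {r : ℕ} {c : Fin n →₀ ℕ} :
    lowPart r c = 0 ↔ ∀ i : Fin n, i.val < r → c i = 0 :=
  Finsupp.filter_eq_zero_iff _ _

variable {k : Type*} [Field k]

/-- The polynomials all of whose exponents have their low part in `T`. -/
noncomputable def lowSupported (k : Type*) [Field k] {n : ℕ} (r : ℕ) (T : Set (Fin n →₀ ℕ)) :
    Submodule k (MvPolynomial (Fin n) k) :=
  restrictSupport k {c | lowPart r c ∈ T}

variable {r : ℕ} {T : Set (Fin n →₀ ℕ)}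

theorem mem_lowSupported {f : MvPolynomial (Fin n) k} :
    f ∈ lowSupported k r T ↔ ∀ c, coeff c f ≠ 0 → lowPart r c ∈ T := by
  simp [lowSupported, mem_restrictSupport_iff, Set.subset_def]

theorem monomial_mem_lowSupported {c : Fin n →₀ ℕ} (h : lowPart r c ∈ T) (a : k) :
    monomial c a ∈ lowSupported k r T :=
  (monomial_mem_restrictSupport k).2 (Or.inl h)

theorem lowSupported_induction {p : MvPolynomial (Fin n) k → Prop}
    (hadd : ∀ f g, p f → p g → p (f + g)) (h0 : p 0)
    (hmon : ∀ c (a : k), lowPart r c ∈ T → p (monomial c a))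
    {f : MvPolynomial (Fin n) k} (hf : f ∈ lowSupported k r T) : p f := by
  rw [← support_sum_monomial_coeff f]
  exact Finset.sum_induction _ p hadd h0 fun c hc =>
    hmon c _ (mem_lowSupported.1 hf c (mem_support_iff.1 hc))

theorem mul_mem_lowSupported {d f : MvPolynomial (Fin n) k} (hd : d ∈ lowSupported k r {0})
    (hf : f ∈ lowSupported k r T) : d * f ∈ lowSupported k r T := by
  refine lowSupported_induction (p := fun d => d * f ∈ lowSupported k r T) ?_ ?_ ?_ hd
  · intro f g hf hg
    rw [add_mul]
    exact add_mem hf hg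
  · simp
  · intro c a hc
    refine lowSupported_induction (p := fun f => monomial c a * f ∈ lowSupported k r T)
      ?_ ?_ ?_ hf
    · intro f g hf hg
      rw [mul_add]
      exact add_mem hf hg
    · simp
    · intro c' a' hc'
      rw [monomial_mul]
      apply monomial_mem_lowSupported
      rw [lowPart_add, Set.mem_singleton_iff.1 hc, zero_add]
      exact hc'

theorem exists_lowSupported_add_compl (r : ℕ) (T : Set (Fin n →₀ ℕ)) (f : MvPolynomial (Fin n) k) :
    ∃ g ∈ lowSupported k r T, ∃ h ∈ lowSupported k r Tᶜ, f = g + h := by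
  induction f using MvPolynomial.induction_on' with
  | monomial c a =>
    by_cases hc : lowPart r c ∈ T
    · exact ⟨_, monomial_mem_lowSupported hc a, 0, zero_mem _, (add_zero _).symm⟩
    · exact ⟨0, zero_mem _, _, monomial_mem_lowSupported hc a, (zero_add _).symm⟩
  | add f f' hf hf' =>
    obtain ⟨g, hg, h, hh, rfl⟩ := hf
    obtain ⟨g', hg', h', hh', rfl⟩ := hf'
    exact ⟨g + g', add_mem hg hg', h + h', add_mem hh hh', by ring⟩

theorem eq_zero_of_mem_lowSupported_compl {f : MvPolynomial (Fin n) k}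
    (hf : f ∈ lowSupported k r T) (hf' : f ∈ lowSupported k r Tᶜ) : f = 0 := by
  ext c
  by_contra hc
  exact mem_lowSupported.1 hf' c hc (mem_lowSupported.1 hf c hc)

/-- The pieces supported on `T` and on its complement are both stable under multiplication by
polynomials in the high variables and meet in `0`. So `d` kills the complementary piece of `f`,
which vanishes because `d ≠ 0`. -/
theorem mem_lowSupported_of_mul_mem {d f : MvPolynomial (Fin n) k}
    (hd : d ∈ lowSupported k r {0}) (hd0 : d ≠ 0) (hf : d * f ∈ lowSupported k r T) :
    f ∈ lowSupported k r T := by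
  obtain ⟨g, hg, h, hh, rfl⟩ := exists_lowSupported_add_compl r T f
  have h1 : d * h ∈ lowSupported k r T := by
    have := sub_mem hf (mul_mem_lowSupported hd hg)
    rwa [mul_add, add_sub_cancel_left] at this
  have h2 := eq_zero_of_mem_lowSupported_compl h1 (mul_mem_lowSupported hd hh)
  rw [(mul_eq_zero.1 h2).resolve_left hd0, add_zero]
  exact hg

theorem mem_lowSupported_zero_iff {f : MvPolynomial (Fin n) k} :
    f ∈ lowSupported k r {0} ↔ ∀ i : Fin n, i.val < r → degreeOf i f = 0 := by
  simp only [mem_lowSupported, Set.mem_singleton_iff, lowPart_eq_zero_iff, degreeOf_eq_sup,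
    ← Nat.bot_eq_zero, Finset.sup_eq_bot_iff, mem_support_iff]
  exact ⟨fun h i hi c hc => h c hc i hi, fun h c hc i hi => h i hi c hc⟩

theorem mem_lowSupported_zero_of_dvd {d g : MvPolynomial (Fin n) k} (hg : g ≠ 0)
    (hg' : g ∈ lowSupported k r {0}) (hdvd : d ∣ g) : d ∈ lowSupported k r {0} := by
  obtain ⟨q, rfl⟩ := hdvd
  rw [mem_lowSupported_zero_iff] at hg' ⊢
  intro i hi
  have := hg' i hi
  rw [degreeOf_mul_eq (left_ne_zero_of_mul hg) (right_ne_zero_of_mul hg)] at this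
  omega

/-- As `s` is low, divisibility by `x^s` depends only on low parts, so no term of `h` survives the
division. -/
theorem divMonomial_of_eq_add {s : Fin n →₀ ℕ} (hs : lowPart r s = s)
    {q h : MvPolynomial (Fin n) k} (hh : h ∈ lowSupported k r {w | ¬ s ≤ w}) :
    (monomial s 1 * q + h).divMonomial s = q := by
  rw [add_divMonomial, divMonomial_monomial_mul]
  convert add_zero q
  ext c
  rw [coeff_divMonomial, coeff_zero]
  by_contra hc
  apply mem_lowSupported.1 hh _ hc
  rw [lowPart_add, hs]
  exact le_self_add

theorem modMonomial_mem_lowSupported (s : Fin n →₀ ℕ) (f : MvPolynomial (Fin n) k) :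
    f.modMonomial s ∈ lowSupported k r {w | ¬ s ≤ w} := by
  refine mem_lowSupported.2 fun c hc hle => hc ?_
  exact coeff_modMonomial_of_le f (hle.trans (lowPart_le r c))

theorem mul_divMonomial_of_mem_lowSupported {s : Fin n →₀ ℕ} (hs : lowPart r s = s)
    {d f : MvPolynomial (Fin n) k} (hd : d ∈ lowSupported k r {0}) :
    (d * f).divMonomial s = d * (f.divMonomial s) := by
  have h : d * f = monomial s 1 * (d * (f.divMonomial s)) + d * (f.modMonomial s) := by
    conv_lhs => rw [← divMonomial_add_modMonomial f s]
    ring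
  rw [h]
  exact divMonomial_of_eq_add hs (mul_mem_lowSupported hd (modMonomial_mem_lowSupported s f))

section Hom

variable {φ : MvPolynomial (Fin n) k →ₐ[k] MvPolynomial (Fin n) k}

theorem map_monomial_of_fixes_low (hφ : ∀ i : Fin n, i.val < r → φ (X i) = X i)
    {s : Fin n →₀ ℕ} (hs : lowPart r s = s) : φ (monomial s 1) = monomial s 1 := by
  rw [monomial_eq, C_1, one_mul, Finsupp.prod, map_prod]
  refine Finset.prod_congr rfl fun i hi => ?_
  rw [map_pow, hφ i]
  by_contra h
  exact Finsupp.mem_support_iff.1 hi (lowPart_eq_self_iff.1 hs i (by omega))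

/-- Each monomial splits into a low factor, fixed by `φ`, and a high factor, sent to a polynomial in
the high variables; hence low parts are preserved. -/
theorem map_mem_lowSupported (hφ : ∀ i : Fin n, i.val < r → φ (X i) = X i)
    (hφ' : ∀ i : Fin n, r ≤ i.val → φ (X i) ∈ lowSupported k r {0})
    {f : MvPolynomial (Fin n) k} (hf : f ∈ lowSupported k r T) : φ f ∈ lowSupported k r T := by
  refine lowSupported_induction (p := fun f => φ f ∈ lowSupported k r T) ?_ ?_ ?_ hf
  · intro f g hf hg
    rw [map_add]
    exact add_mem hf hg
  · simp
  · intro c a hc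
    have hone : (1 : MvPolynomial (Fin n) k) ∈ lowSupported k r {0} :=
      monomial_mem_lowSupported (c := 0) (lowPart_zero r) 1
    have hpow : ∀ (g : MvPolynomial (Fin n) k) (e : ℕ), g ∈ lowSupported k r {0} →
        g ^ e ∈ lowSupported k r {0} := by
      intro g e hg
      induction e with
      | zero => simpa using hone
      | succ e ih => rw [pow_succ]; exact mul_mem_lowSupported ih hg
    have hhigh : φ (monomial (c - lowPart r c) 1) ∈ lowSupported k r {0} := by
      rw [monomial_eq, C_1, one_mul, Finsupp.prod, map_prod]
      refine Finset.prod_induction _ (· ∈ lowSupported k r {0})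
        (fun _ _ => mul_mem_lowSupported) hone fun i hi => ?_
      rw [map_pow]
      refine hpow _ _ (hφ' i ?_)
      by_contra h
      rw [Finsupp.mem_support_iff, Finsupp.tsub_apply, lowPart_apply, if_pos (by omega)] at hi
      omega
    have hsplit : monomial c a =
        a • (monomial (c - lowPart r c) 1 * monomial (lowPart r c) (1 : k)) := by
      rw [monomial_mul, tsub_add_cancel_of_le (lowPart_le r c), smul_monomial]
      simp
    rw [hsplit, map_smul, map_mul, map_monomial_of_fixes_low hφ (lowPart_lowPart r c)]
    refine Submodule.smul_mem _ _ (mul_mem_lowSupported hhigh (monomial_mem_lowSupported ?_ 1))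
    rwa [lowPart_lowPart]

theorem map_divMonomial (hφ : ∀ i : Fin n, i.val < r → φ (X i) = X i)
    (hφ' : ∀ i : Fin n, r ≤ i.val → φ (X i) ∈ lowSupported k r {0})
    {s : Fin n →₀ ℕ} (hs : lowPart r s = s) (f : MvPolynomial (Fin n) k) :
    (φ f).divMonomial s = φ (f.divMonomial s) := by
  conv_lhs => rw [← divMonomial_add_modMonomial f s, map_add, map_mul,
    map_monomial_of_fixes_low hφ hs]
  exact divMonomial_of_eq_add hs (map_mem_lowSupported hφ hφ' (modMonomial_mem_lowSupported s f))

end Hom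

end Low

/-! ### Leading exponents and reduced elements of an ideal. -/

section LeadingExponents

open scoped MonomialOrder

variable {k : Type*} [Field k] {n : ℕ}

/-- The exponents of the leading monomials of the nonzero elements of `Q`. -/
def leadingExponents (m : MonomialOrder (Fin n)) (Q : Ideal (MvPolynomial (Fin n) k)) :
    Set (Fin n →₀ ℕ) :=
  {c | ∃ f ∈ Q, f ≠ 0 ∧ m.degree f = c}

variable {m : MonomialOrder (Fin n)} {Q : Ideal (MvPolynomial (Fin n) k)}

theorem isUpperSet_leadingExponents (m : MonomialOrder (Fin n))
    (Q : Ideal (MvPolynomial (Fin n) k)) : IsUpperSet (leadingExponents m Q) := by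
  classical
  rintro c d hcd ⟨f, hf, hf0, rfl⟩
  have h0 : (monomial (d - m.degree f) (1 : k)) ≠ 0 := by simp
  refine ⟨_, Q.mul_mem_left (monomial (d - m.degree f) 1) hf, mul_ne_zero h0 hf0, ?_⟩
  rw [m.degree_mul h0 hf0, m.degree_monomial, if_neg one_ne_zero, tsub_add_cancel_of_le hcd]

theorem initialIdeal_eq_span (m : MonomialOrder (Fin n)) (Q : Ideal (MvPolynomial (Fin n) k)) :
    initialIdeal m Q = Ideal.span ((fun c => monomial c 1) '' leadingExponents m Q) := by
  unfold initialIdeal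
  congr 1
  ext g
  constructor
  · rintro ⟨f, hf, hf0, rfl⟩
    exact ⟨_, ⟨f, hf, hf0, rfl⟩, rfl⟩
  · rintro ⟨_, ⟨f, hf, hf0, rfl⟩, rfl⟩
    exact ⟨f, hf, hf0, rfl⟩

theorem monomial_mem_span_monomial_iff {T : Set (Fin n →₀ ℕ)} {c : Fin n →₀ ℕ} :
    monomial c (1 : k) ∈ Ideal.span ((fun c => monomial c (1 : k)) '' T) ↔ ∃ t ∈ T, t ≤ c := by
  classical
  rw [mem_ideal_span_monomial_image, support_monomial, if_neg one_ne_zero]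
  simp

theorem monomial_mem_initialIdeal_iff {c : Fin n →₀ ℕ} :
    monomial c 1 ∈ initialIdeal m Q ↔ c ∈ leadingExponents m Q := by
  rw [initialIdeal_eq_span, monomial_mem_span_monomial_iff]
  exact ⟨fun ⟨t, ht, htc⟩ => isUpperSet_leadingExponents m Q htc ht, fun h => ⟨c, h, le_rfl⟩⟩

/-- Every leading monomial is the leading monomial of an element of `Q` whose other monomials are
standard. -/
theorem exists_reduced_of_mem_leadingExponents {c : Fin n →₀ ℕ} (hc : c ∈ leadingExponents m Q) :
    ∃ f ∈ Q, f ≠ 0 ∧ m.degree f = c ∧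
      ∀ d, coeff d f ≠ 0 → d = c ∨ d ∉ leadingExponents m Q := by
  classical
  -- Divide `x^c` by all nonzero elements of `Q`: the remainder `t` has only standard monomials, and
  -- `x^c - t` is the required element.
  obtain ⟨q, t, hqt, hdeg, ht⟩ := m.div_set (B := {f | f ∈ Q ∧ f ≠ 0})
    (fun b hb => (m.leadingCoeff_ne_zero_iff.2 hb.2).isUnit) (monomial c (1 : k))
  have hmem : Finsupp.linearCombination _ (fun b : {f | f ∈ Q ∧ f ≠ 0} =>
      (b : MvPolynomial (Fin n) k)) q ∈ Q :=
    Q.sum_mem fun b _ => Q.mul_mem_left _ b.2.1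
  have hle : m.degree (Finsupp.linearCombination _ (fun b : {f | f ∈ Q ∧ f ≠ 0} =>
      (b : MvPolynomial (Fin n) k)) q) ≼[m] c := by
    rw [Finsupp.linearCombination_apply, Finsupp.sum]
    refine m.degree_sum_le.trans (Finset.sup_le fun b _ => ?_)
    have := hdeg b
    rwa [m.degree_monomial, if_neg one_ne_zero, mul_comm, ← smul_eq_mul] at this
  have hstd : ∀ d, coeff d t ≠ 0 → d ∉ leadingExponents m Q := by
    rintro d hd ⟨f, hf, hf0, rfl⟩
    exact ht _ (mem_support_iff.2 hd) f ⟨hf, hf0⟩ le_rfl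
  generalize Finsupp.linearCombination _ (fun b : {f | f ∈ Q ∧ f ≠ 0} =>
      (b : MvPolynomial (Fin n) k)) q = f at hqt hmem hle
  have hft : ∀ d, coeff d f = (if c = d then 1 else 0) - coeff d t := by
    intro d
    rw [← coeff_monomial, hqt, coeff_add, add_sub_cancel_right]
  have hct : coeff c t = 0 := by
    by_contra h
    exact hstd c h hc
  have hcf : coeff c f ≠ 0 := by
    rw [hft, if_pos rfl, hct, sub_zero]
    exact one_ne_zero
  refine ⟨f, hmem, fun h => hcf (by rw [h, coeff_zero]), ?_, fun d hd => ?_⟩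
  · exact m.toSyn.injective (le_antisymm hle (m.le_degree (mem_support_iff.2 hcf)))
  · rcases eq_or_ne d c with h | h
    · exact Or.inl h
    · refine Or.inr (hstd d fun h0 => hd ?_)
      rw [hft, if_neg h.symm, h0, sub_zero]

end LeadingExponents

/-! ### The coefficients of `x^s` in a prime ideal whose leading exponents have socle shape. -/

section SocleShape

open scoped MonomialOrder

variable {k : Type*} [Field k] {n r : ℕ}

/-- Combinatorial shape of a set `M` of monomials whose generators outside the first `r` variables
all restrict to one socle monomial `x^s` of the first `r` variables. -/
structure IsSocleShape (r : ℕ) (M : Set (Fin n →₀ ℕ)) (s : Fin n →₀ ℕ) : Prop where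
  isUpperSet : IsUpperSet M
  lowPart_eq : lowPart r s = s
  notMem : s ∉ M
  add_single_mem : ∀ i : Fin n, i.val < r → s + Finsupp.single i 1 ∈ M
  lowPart_mem : ∀ c ∈ M, lowPart r c ∈ M ∨ lowPart r c = s
  exists_lowPart_eq : ∃ c ∈ M, lowPart r c = s

namespace IsSocleShape

variable {M : Set (Fin n →₀ ℕ)} {s : Fin n →₀ ℕ} (h : IsSocleShape r M s)
include h

/-- The socle condition: multiplying `x^s` by any low variable lands in `M`. -/
theorem lowPart_eq_zero_of_add_notMem {c : Fin n →₀ ℕ} (hc : lowPart r (s + c) ∉ M) : lowPart r c = 0 := by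
  rw [lowPart_eq_zero_iff]
  intro i hi
  by_contra hci
  refine hc (h.isUpperSet ?_ (h.add_single_mem i hi))
  rw [lowPart_add, h.lowPart_eq]
  gcongr
  rw [Finsupp.single_le_iff, lowPart_apply, if_pos hi]
  omega

theorem divMonomial_mem {f : MvPolynomial (Fin n) k} (hf : f ∈ lowSupported k r Mᶜ) :
    f.divMonomial s ∈ lowSupported k r {0} := by
  refine mem_lowSupported.2 fun c hc => h.lowPart_eq_zero_of_add_notMem ?_
  rw [coeff_divMonomial] at hc
  exact mem_lowSupported.1 hf _ hc

variable {m : MonomialOrder (Fin n)} {Q : Ideal (MvPolynomial (Fin n) k)}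
  (hM : leadingExponents m Q = M)
include hM

/-- The leading exponent is in `M` while its low part is not, so that low part is `s`. The leading
term therefore survives division by `x^s`, and the order is translation invariant. -/
theorem degree_eq_add {f : MvPolynomial (Fin n) k} (hf : f ∈ lowSupported k r Mᶜ) (hfQ : f ∈ Q)
    (hf0 : f ≠ 0) : f.divMonomial s ≠ 0 ∧ m.degree f = s + m.degree (f.divMonomial s) := by
  have hdeg : m.degree f ∈ M := hM ▸ ⟨f, hfQ, hf0, rfl⟩
  have hlow : lowPart r (m.degree f) = s :=
    (h.lowPart_mem _ hdeg).resolve_left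
      (mem_lowSupported.1 hf _ (m.coeff_degree_ne_zero_iff.2 hf0))
  obtain ⟨t, ht⟩ := exists_add_of_le (hlow ▸ lowPart_le r (m.degree f) : s ≤ m.degree f)
  have hcoeff : coeff t (f.divMonomial s) ≠ 0 := by
    rw [coeff_divMonomial, ← ht]
    exact m.coeff_degree_ne_zero_iff.2 hf0
  refine ⟨fun h0 => hcoeff (by rw [h0, coeff_zero]), ?_⟩
  rw [ht]
  congr 1
  apply m.toSyn.injective
  refine le_antisymm (m.le_degree (mem_support_iff.2 hcoeff)) (m.degree_le_iff.2 fun c hc => ?_)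
  rw [mem_support_iff, coeff_divMonomial] at hc
  have := m.le_degree (mem_support_iff.2 hc)
  rw [ht, map_add, map_add] at this
  exact le_of_add_le_add_left this

/-- A leading exponent with low part `0` would force `0 ∈ M`, hence `s ∈ M`, or else `s = 0`. -/
theorem eq_zero_of_mem_lowSupported_zero (hs : s ≠ 0) {f : MvPolynomial (Fin n) k}
    (hf : f ∈ lowSupported k r {0}) (hfQ : f ∈ Q) : f = 0 := by
  by_contra hf0
  have hdeg : m.degree f ∈ M := hM ▸ ⟨f, hfQ, hf0, rfl⟩
  have hlow : lowPart r (m.degree f) = 0 :=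
    mem_lowSupported.1 hf _ (m.coeff_degree_ne_zero_iff.2 hf0)
  rcases h.lowPart_mem _ hdeg with h1 | h1
  · rw [hlow] at h1
    exact h.notMem (h.isUpperSet zero_le h1)
  · exact hs (h1.symm.trans hlow)

/-- The `x^s`-coefficients of the elements of a prime ideal `Q` that are supported on low monomials
outside `M` are all multiples of one of them. -/
theorem exists_generator [hQ : Q.IsPrime] (hs : s ≠ 0) :
    ∃ f ∈ Q, f ∈ lowSupported k r Mᶜ ∧ f ≠ 0 ∧
      ∀ f' ∈ Q, f' ∈ lowSupported k r Mᶜ → f.divMonomial s ∣ f'.divMonomial s := by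
  obtain ⟨f₁, hf₁Q, hf₁, hf₁0⟩ : ∃ f ∈ Q, f ∈ lowSupported k r Mᶜ ∧ f ≠ 0 := by
    obtain ⟨c, hc, hcs⟩ := h.exists_lowPart_eq
    obtain ⟨f, hfQ, hf0, -, hf⟩ := exists_reduced_of_mem_leadingExponents (hM ▸ hc)
    refine ⟨f, hfQ, mem_lowSupported.2 fun d hd hdM => ?_, hf0⟩
    rcases hf d hd with rfl | hd'
    · exact h.notMem (hcs ▸ hdM)
    · exact hd' (hM ▸ h.isUpperSet (lowPart_le r d) hdM)
  -- Choose `f` with `x^s`-coefficient minimal for strict divisibility, which is well founded in a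
  -- polynomial ring over a field.
  obtain ⟨g, ⟨f, ⟨hfQ, hf, hf0⟩, rfl⟩, hmin⟩ :=
    (IsWellFounded.wf (r := DvdNotUnit (α := MvPolynomial (Fin n) k))).has_min
      ((fun f => f.divMonomial s) '' {f | f ∈ Q ∧ f ∈ lowSupported k r Mᶜ ∧ f ≠ 0})
      ⟨_, f₁, ⟨hf₁Q, hf₁, hf₁0⟩, rfl⟩
  refine ⟨f, hfQ, hf, hf0, fun f' hf'Q hf' => ?_⟩
  have hg0 := (h.degree_eq_add hM hf hfQ hf0).1
  have hg := h.divMonomial_mem hf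
  have hg' := h.divMonomial_mem hf'
  -- A common divisor `d` involves only high variables, so `d ∉ Q` and primality puts `q = f / d` in
  -- `Q`. The coefficient of `q` would contradict minimality unless `d` is a unit.
  have hrel : IsRelPrime (f.divMonomial s) f := by
    rintro d hdg ⟨q, rfl⟩
    have hd := mem_lowSupported_zero_of_dvd hg0 hg hdg
    have hd0 := left_ne_zero_of_mul hf0
    have hqQ : q ∈ Q := (hQ.mem_or_mem hfQ).resolve_left fun hdQ =>
      hd0 (h.eq_zero_of_mem_lowSupported_zero hM hs hd hdQ)
    have hq0 := right_ne_zero_of_mul hf0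
    have hq := mem_lowSupported_of_mul_mem hd hd0 hf
    by_contra hunit
    refine hmin _ ⟨q, ⟨hqQ, hq, hq0⟩, rfl⟩ ⟨(h.degree_eq_add hM hq hqQ hq0).1, d, hunit, ?_⟩
    dsimp only
    rw [mul_divMonomial_of_mem_lowSupported h.lowPart_eq hd, mul_comm]
  -- The difference lies in `Q` and has no low part in `M`, but its `x^s`-coefficient is zero;
  -- `degree_eq_add` excludes this for nonzero elements.
  have hzero : f.divMonomial s * f' - f'.divMonomial s * f = 0 := by
    by_contra hne
    refine (h.degree_eq_add hM (sub_mem (mul_mem_lowSupported hg hf')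
      (mul_mem_lowSupported hg' hf)) (sub_mem (Q.mul_mem_left _ hf'Q)
      (Q.mul_mem_left _ hfQ)) hne).1 ?_
    have hadd := add_divMonomial (f.divMonomial s * f' - f'.divMonomial s * f)
      (f'.divMonomial s * f) s
    rw [sub_add_cancel, mul_divMonomial_of_mem_lowSupported h.lowPart_eq hg,
      mul_divMonomial_of_mem_lowSupported h.lowPart_eq hg', mul_comm] at hadd
    exact right_eq_add.1 hadd
  exact hrel.dvd_of_dvd_mul_right ⟨f', (sub_eq_zero.1 hzero).symm⟩

end IsSocleShape

end SocleShape

/-! ### Linear changes of coordinates and the coefficients of pure powers. -/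

section LinearSubst

variable {k : Type*} [Field k] {n : ℕ}

theorem linearSubst_X (α : GL (Fin n) k) (j : Fin n) :
    linearSubst α (X j) = ∑ i, C (α.val i j) * X i := aeval_X _ _

theorem linearSubst_mul (β α : GL (Fin n) k) :
    linearSubst (β * α) = (linearSubst β).comp (linearSubst α) := by
  ext1 j
  rw [AlgHom.comp_apply, linearSubst_X, linearSubst_X, map_sum]
  simp_rw [map_mul, linearSubst_X, algHom_C, Units.val_mul, Matrix.mul_apply, map_sum,
    Finset.mul_sum, Finset.sum_mul]
  rw [Finset.sum_comm]
  refine Finset.sum_congr rfl fun i _ => Finset.sum_congr rfl fun l _ => ?_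
  simp only [algebraMap_eq, map_mul]
  ring

theorem linearSubst_one : linearSubst (1 : GL (Fin n) k) = AlgHom.id k _ := by
  ext1 j
  rw [linearSubst_X]
  simp [Matrix.one_apply]

/-- A linear change of coordinates as an automorphism. -/
noncomputable def linearSubstEquiv (α : GL (Fin n) k) :
    MvPolynomial (Fin n) k ≃ₐ[k] MvPolynomial (Fin n) k :=
  AlgEquiv.ofAlgHom (linearSubst α) (linearSubst α⁻¹)
    (by rw [← linearSubst_mul, mul_inv_cancel, linearSubst_one])
    (by rw [← linearSubst_mul, inv_mul_cancel, linearSubst_one])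

theorem isPrime_map_linearSubst (α : GL (Fin n) k) (P : Ideal (MvPolynomial (Fin n) k))
    [P.IsPrime] : (P.map (linearSubst α)).IsPrime :=
  Ideal.map_isPrime_of_equiv (linearSubstEquiv α)

theorem totalDegree_linearSubst_le (α : GL (Fin n) k) (f : MvPolynomial (Fin n) k) :
    (linearSubst α f).totalDegree ≤ f.totalDegree := by
  have hX : ∀ j, (linearSubst α (X j)).totalDegree ≤ 1 := by
    intro j
    rw [linearSubst_X]
    refine totalDegree_finsetSum_le fun i _ => (totalDegree_mul _ _).trans ?_
    simp
  conv_lhs => rw [← support_sum_monomial_coeff f, map_sum]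
  refine totalDegree_finsetSum_le fun c hc => ?_
  rw [monomial_eq, map_mul, algHom_C, Finsupp.prod, map_prod]
  refine (totalDegree_mul _ _).trans ?_
  rw [algebraMap_eq, totalDegree_C, zero_add]
  refine (totalDegree_finsetProd _ _).trans (le_trans ?_ (le_totalDegree hc))
  refine Finset.sum_le_sum fun i _ => ?_
  rw [map_pow]
  exact (totalDegree_pow _ _).trans (by simpa using Nat.mul_le_mul_left (c i) (hX i))

theorem coeff_single_eq_coeff_aeval (p : Fin n) (e : ℕ) (g : MvPolynomial (Fin n) k) :
    coeff (Finsupp.single p e) g =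
      (aeval (Pi.single p (Polynomial.X : Polynomial k)) g).coeff e := by
  induction g using MvPolynomial.induction_on' with
  | add f g hf hg => rw [coeff_add, map_add, Polynomial.coeff_add, hf, hg]
  | monomial c a =>
    rw [coeff_monomial, aeval_monomial, Polynomial.algebraMap_eq, Polynomial.coeff_C_mul]
    by_cases hc : ∀ i, i ≠ p → c i = 0
    · have hcp : c = Finsupp.single p (c p) := by
        ext i
        rcases eq_or_ne i p with rfl | hi
        · simp
        · rw [hc i hi, Finsupp.single_eq_of_ne hi]
      rw [hcp, Finsupp.prod_single_index (by rw [pow_zero]), Pi.single_eq_same, Polynomial.coeff_X_pow]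
      by_cases he : c p = e
      · simp [he]
      · rw [if_neg, if_neg (Ne.symm he), mul_zero]
        exact fun h => he (Finsupp.single_injective p h)
    · push Not at hc
      obtain ⟨i, hi, hci⟩ := hc
      rw [if_neg, Finsupp.prod, Finset.prod_eq_zero (Finsupp.mem_support_iff.2 hci),
        Polynomial.coeff_zero, mul_zero]
      · rw [Pi.single_eq_of_ne hi, zero_pow hci]
      · rintro rfl
        exact hci (Finsupp.single_eq_of_ne hi)

theorem coeff_aeval_C_mul_X (b : Fin n → k) (e : ℕ) (f : MvPolynomial (Fin n) k) :
    (aeval (fun j => Polynomial.C (b j) * Polynomial.X) f).coeff e =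
      eval b (homogeneousComponent e f) := by
  induction f using MvPolynomial.induction_on' with
  | add f g hf hg => rw [map_add, Polynomial.coeff_add, hf, hg, map_add, map_add]
  | monomial c a =>
    have hprod : (c.prod fun j e => (Polynomial.C (b j) * Polynomial.X) ^ e) =
        Polynomial.C (c.prod fun j e => b j ^ e) * Polynomial.X ^ c.degree := by
      simp only [Finsupp.prod, mul_pow, Finset.prod_mul_distrib, map_prod, map_pow,
        Finset.prod_pow_eq_pow_sum]
      rfl
    rw [aeval_monomial, hprod, Polynomial.algebraMap_eq, ← mul_assoc, ← map_mul,
      Polynomial.coeff_C_mul_X_pow]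
    by_cases he : e = c.degree
    · rw [if_pos he, homogeneousComponent_of_mem (isHomogeneous_monomial a rfl), if_pos he,
        eval_monomial]
    · rw [if_neg he, homogeneousComponent_of_mem (isHomogeneous_monomial a rfl), if_neg he,
        map_zero]

/-- Setting every variable except `x_p` to zero after the substitution sends `x_j` to `α p j * x_p`.
-/
theorem coeff_single_linearSubst (α : GL (Fin n) k) (p : Fin n) (e : ℕ)
    (f : MvPolynomial (Fin n) k) :
    coeff (Finsupp.single p e) (linearSubst α f) =
      eval (fun j => α.val p j) (homogeneousComponent e f) := by
  rw [coeff_single_eq_coeff_aeval, ← coeff_aeval_C_mul_X, ← AlgHom.comp_apply]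
  congr 2
  ext1 j
  rw [AlgHom.comp_apply, linearSubst_X, map_sum, aeval_X, Finset.sum_eq_single p]
  · simp
  · intro i _ hi
    simp [hi]
  · simp

end LinearSubst

/-! ### Generic row shears and leading monomials in reverse lexicographic order. -/

section Generic

open scoped MonomialOrder

variable {k : Type*} [Field k] {n : ℕ}

/-- Among monomials of degree at most `e` in `x_p` and later variables, `x_p^e` is the largest: any
other one of degree `e` involves a later variable, and the last such variable decides the
comparison. -/
theorem degree_degRevLex_eq_single {p : Fin n} {e : ℕ} {g : MvPolynomial (Fin n) k}
    (hg : g ∈ lowSupported k p.val {0}) (he : g.totalDegree ≤ e)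
    (hcoeff : coeff (Finsupp.single p e) g ≠ 0) :
    (degRevLex n).degree g = Finsupp.single p e := by
  apply (degRevLex n).toSyn.injective
  refine le_antisymm ((degRevLex n).degree_le_iff.2 fun c hc => ?_)
    ((degRevLex n).le_degree (mem_support_iff.2 hcoeff))
  rcases eq_or_ne c (Finsupp.single p e) with rfl | hne
  · exact le_rfl
  refine le_of_lt ((degRevLex_lt_iff _ _).2 ?_)
  have hlow := lowPart_eq_zero_iff.1 (mem_lowSupported.1 hg c (mem_support_iff.1 hc))
  have hdeg : c.degree ≤ e := (le_totalDegree hc).trans he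
  rw [Finsupp.degree_single]
  rcases hdeg.lt_or_eq with hlt | heq
  · exact Or.inl hlt
  refine Or.inr ⟨heq, ?_⟩
  have hex : (Finset.univ.filter fun i : Fin n => p < i ∧ c i ≠ 0).Nonempty := by
    by_contra hemp
    rw [Finset.not_nonempty_iff_eq_empty, Finset.filter_eq_empty_iff] at hemp
    have hcp : c = Finsupp.single p (c p) := by
      ext i
      rcases lt_trichotomy i p with hi | rfl | hi
      · rw [hlow i hi, Finsupp.single_eq_of_ne hi.ne]
      · simp
      · rw [Finsupp.single_eq_of_ne hi.ne']
        by_contra hci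
        exact hemp (Finset.mem_univ i) ⟨hi, hci⟩
    rw [hcp, Finsupp.degree_single] at heq
    exact hne (heq ▸ hcp)
  obtain ⟨i, hi, hmax⟩ := Finset.exists_max_image _ id hex
  rw [Finset.mem_filter] at hi
  refine ⟨i, ?_, fun j hj => ?_⟩
  · rw [Finsupp.single_eq_of_ne hi.2.1.ne']
    exact Nat.pos_of_ne_zero hi.2.2
  · rw [Finsupp.single_eq_of_ne (hi.2.1.trans hj).ne']
    by_contra hcj
    exact absurd (hmax j (Finset.mem_filter.2 ⟨Finset.mem_univ j, hi.2.1.trans hj, hcj⟩))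
      (not_le.2 hj)

/-- The identity matrix with the entries of the `p`-th row from the diagonal on replaced by those
of `d`. -/
def rowShear {R : Type*} [CommRing R] (p : Fin n) (d : Fin n → R) : Matrix (Fin n) (Fin n) R :=
  (1 : Matrix (Fin n) (Fin n) R).updateRow p fun j => if j < p then 0 else d j

theorem det_rowShear {R : Type*} [CommRing R] (p : Fin n) (d : Fin n → R) :
    (rowShear p d).det = d p := by
  rw [rowShear, ← Matrix.cramer_transpose_apply, Matrix.transpose_one, Matrix.cramer_one]
  simp

theorem rowShear_single {R : Type*} [CommRing R] (p : Fin n) :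
    rowShear p (Pi.single p (1 : R)) = 1 := by
  ext i j
  rw [rowShear, Matrix.updateRow_apply]
  split_ifs with hi hj
  · rw [hi, Matrix.one_apply_ne hj.ne']
  · rw [hi, Matrix.one_apply, Pi.single_apply]
    simp only [eq_comm]
  · rfl

theorem map_rowShear {R R' : Type*} [CommRing R] [CommRing R'] (f : R →+* R') (p : Fin n)
    (d : Fin n → R) (i j : Fin n) : f (rowShear p d i j) = rowShear p (fun j => f (d j)) i j := by
  rw [rowShear, rowShear, Matrix.updateRow_apply, Matrix.updateRow_apply]
  split_ifs
  · exact map_zero f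
  · rfl
  · rw [Matrix.one_apply, Matrix.one_apply]
    split_ifs <;> simp

theorem linearSubst_X_of_rowShear_of_lt {β : GL (Fin n) k} {p : Fin n} {d : Fin n → k}
    (hβ : β.val = rowShear p d) {j : Fin n} (hj : j < p) : linearSubst β (X j) = X j := by
  rw [linearSubst_X, hβ, Finset.sum_eq_single j]
  · rw [rowShear, Matrix.updateRow_ne hj.ne, Matrix.one_apply_eq, C_1, one_mul]
  · intro i _ hi
    rw [rowShear, Matrix.updateRow_apply]
    split_ifs
    · simp
    · rw [Matrix.one_apply_ne hi, C_0, zero_mul]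
  · simp

theorem linearSubst_X_mem_of_rowShear {β : GL (Fin n) k} {p : Fin n} {d : Fin n → k}
    (hβ : β.val = rowShear p d) {j : Fin n} (hj : p ≤ j) :
    linearSubst β (X j) ∈ lowSupported k p.val {0} := by
  rw [linearSubst_X, hβ]
  refine Submodule.sum_mem _ fun i _ => ?_
  by_cases hi : p ≤ i
  · rw [C_mul_X_eq_monomial]
    refine monomial_mem_lowSupported (lowPart_eq_zero_iff.2 fun l hl => ?_) _
    exact Finsupp.single_eq_of_ne (ne_of_lt (lt_of_lt_of_le (Fin.lt_def.2 hl) hi))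
  · rw [rowShear, Matrix.updateRow_ne (ne_of_lt (not_le.1 hi)),
      Matrix.one_apply_ne (ne_of_lt ((not_le.1 hi).trans_le hj)), C_0, zero_mul]
    exact zero_mem _

/-- A generic row shear stays in a given Zariski open set and moves the leading monomial of a
polynomial in `x_p, …, x_{n-1}` to a power of `x_p`. -/
theorem exists_rowShear_degree_eq_single [Infinite k] {U : Set (GL (Fin n) k)}
    (hU : IsZariskiOpen U) {α : GL (Fin n) k} (hα : α ∈ U) {p : Fin n}
    {g : MvPolynomial (Fin n) k} (hg : g ∈ lowSupported k p.val {0}) (hg0 : g ≠ 0) :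
    ∃ (β : GL (Fin n) k) (d : Fin n → k), β.val = rowShear p d ∧ β * α ∈ U ∧
      (degRevLex n).degree (linearSubst β g) = Finsupp.single p g.totalDegree := by
  obtain ⟨F, rfl⟩ := hU
  obtain ⟨f, hf, hfα⟩ := hα
  let G : MvPolynomial (Fin n) k :=
    aeval (fun q : Fin n × Fin n => (rowShear p X * α.val.map C : Matrix _ _ _) q.1 q.2) f
  have hG : ∀ d, eval d G = eval (fun q => (rowShear p d * α.val) q.1 q.2) f := by
    intro d
    have : (fun q : Fin n × Fin n => (rowShear p d * α.val) q.1 q.2) = fun q =>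
        eval d ((rowShear p X * α.val.map C : Matrix _ _ (MvPolynomial (Fin n) k)) q.1 q.2) := by
      funext q
      simp [Matrix.mul_apply, map_rowShear]
    rw [this]
    change _ = eval₂ (RingHom.id k) _ f
    simp only [G, aeval_def, ← coe_eval₂Hom]
    rw [map_eval₂Hom]
    congr 2
    ext
    simp
  -- The unit vector at `p` gives the identity shear, where `G` takes the nonzero value of `f` at
  -- `α`.
  have hG0 : G ≠ 0 := by
    intro h0
    have := hG (Pi.single p 1)
    rw [h0, map_zero, rowShear_single, one_mul] at this
    exact hfα this.symm
  set h := homogeneousComponent g.totalDegree g with hh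
  have hh0 : h ≠ 0 := by
    obtain ⟨c, hc, hcd⟩ := Finset.exists_mem_eq_sup g.support
      (support_nonempty.2 hg0) fun c => c.degree
    intro h0
    have := coeff_homogeneousComponent g.totalDegree g c
    rw [← hh, h0, coeff_zero, if_pos] at this
    · exact mem_support_iff.1 hc this.symm
    · rw [← hcd]
      rfl
  -- The three factors ensure that `β * α` stays in the open set, that the coefficient of the pure
  -- power is nonzero, and that the shear, of determinant `d p`, is invertible.
  obtain ⟨d, hd⟩ : ∃ d, eval d (G * h * X p) ≠ 0 := by
    by_contra! hall
    exact mul_ne_zero (mul_ne_zero hG0 hh0) (X_ne_zero p)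
      (MvPolynomial.funext fun d => by simpa using hall d)
  rw [map_mul, map_mul, eval_X] at hd
  have hdet : (rowShear p d).det ≠ 0 := by
    rw [det_rowShear]
    exact right_ne_zero_of_mul hd
  let β : GL (Fin n) k := Matrix.GeneralLinearGroup.mkOfDetNeZero (rowShear p d) hdet
  have hβ : β.val = rowShear p d := rfl
  refine ⟨β, d, hβ, ⟨f, hf, ?_⟩, degree_degRevLex_eq_single ?_ ?_ ?_⟩
  · rw [Units.val_mul, hβ, ← hG]
    exact left_ne_zero_of_mul (left_ne_zero_of_mul hd)
  · exact map_mem_lowSupported (fun i hi => linearSubst_X_of_rowShear_of_lt hβ hi)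
      (fun i hi => linearSubst_X_mem_of_rowShear hβ hi) hg
  · exact totalDegree_linearSubst_le β g
  -- The shear replaces `d j` by `0` for `j < p`, which is harmless because `h` involves no such
  -- variable.
  · rw [coeff_single_linearSubst, hβ, ← hh]
    convert right_ne_zero_of_mul (left_ne_zero_of_mul hd) using 1
    rw [eval_eq, eval_eq]
    refine Finset.sum_congr rfl fun c hc => ?_
    congr 1
    refine Finset.prod_congr rfl fun i hi => ?_
    rw [rowShear, Matrix.updateRow_self, if_neg]
    intro hip
    rw [hh, mem_support_iff, coeff_homogeneousComponent] at hc
    refine Finsupp.mem_support_iff.1 hi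
      (lowPart_eq_zero_iff.1 (mem_lowSupported.1 hg c fun h0 => hc ?_) i hip)
    rw [h0, ite_self]

end Generic

/-! ### The single extra generator. -/

section ExtraGenerator

variable {k : Type*} [Field k] {n r : ℕ}

/-- A reduced element with leading exponent `c` has no low part in `M`: its other monomials are
standard, so their divisors are too. Its `x^s`-coefficient is then a multiple of `g`. -/
theorem IsSocleShape.add_degree_le {M : Set (Fin n →₀ ℕ)} {s : Fin n →₀ ℕ}
    (h : IsSocleShape r M s) {m : MonomialOrder (Fin n)} {Q : Ideal (MvPolynomial (Fin n) k)}
    (hM : leadingExponents m Q = M) {g : MvPolynomial (Fin n) k}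
    (hg : ∀ f ∈ Q, f ∈ lowSupported k r Mᶜ → g ∣ f.divMonomial s) {c : Fin n →₀ ℕ} (hc : c ∈ M)
    (hlow : lowPart r c ∉ M) : s + m.degree g ≤ c := by
  obtain ⟨f, hfQ, hf0, rfl, hf⟩ := exists_reduced_of_mem_leadingExponents (hM ▸ hc)
  have hfM : f ∈ lowSupported k r Mᶜ := by
    refine mem_lowSupported.2 fun d hd hdM => ?_
    rcases hf d hd with rfl | hd'
    · exact hlow hdM
    · exact hd' (hM ▸ h.isUpperSet (lowPart_le r d) hdM)
  obtain ⟨hne, hdeg⟩ := h.degree_eq_add hM hfM hfQ hf0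
  obtain ⟨q, hq⟩ := hg f hfQ hfM
  rw [hq] at hne
  rw [hdeg, hq, m.degree_mul (left_ne_zero_of_mul hne) (right_ne_zero_of_mul hne)]
  gcongr
  exact le_self_add

/-- If the leading exponents of the generic coordinate changes of a prime ideal have socle shape at
`s ≠ 0`, then they are generated by their low parts and one further monomial `x^s * x_p ^ e`. -/
theorem IsSocleShape.exists_add_single [Infinite k] {M : Set (Fin n →₀ ℕ)} {s : Fin n →₀ ℕ}
    {p : Fin n} (h : IsSocleShape p.val M s) (hs : s ≠ 0) {P : Ideal (MvPolynomial (Fin n) k)}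
    (hP : P.IsPrime) {U : Set (GL (Fin n) k)} (hU : IsZariskiOpen U) (hne : U.Nonempty)
    (hM : ∀ α ∈ U, leadingExponents (degRevLex n) (P.map (linearSubst α)) = M) :
    ∃ e : ℕ, 0 < e ∧ s + Finsupp.single p e ∈ M ∧
      ∀ c ∈ M, lowPart p.val c ∉ M → s + Finsupp.single p e ≤ c := by
  obtain ⟨α, hα⟩ := hne
  have hQ := isPrime_map_linearSubst α P
  obtain ⟨f, hfQ, hf, hf0, hdvd⟩ := h.exists_generator (hM α hα) hs
  obtain ⟨hg0, hdeg⟩ := h.degree_eq_add (hM α hα) hf hfQ hf0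
  have hmin := fun c hc hlow => h.add_degree_le (hM α hα) hdvd (c := c) hc hlow
  have hmem : s + (degRevLex n).degree (f.divMonomial s) ∈ M := by
    rw [← hdeg, ← hM α hα]
    exact ⟨f, hfQ, hf0, rfl⟩
  obtain ⟨β, d, hβ, hβα, hdegβ⟩ :=
    exists_rowShear_degree_eq_single hU hα (h.divMonomial_mem hf) hg0
  set E := (f.divMonomial s).totalDegree
  have hlt : ∀ i : Fin n, i.val < p.val → linearSubst β (X i) = X i := fun i hi =>
    linearSubst_X_of_rowShear_of_lt hβ hi
  have hge : ∀ i : Fin n, p.val ≤ i.val → linearSubst β (X i) ∈ lowSupported k p.val {0} :=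
    fun i hi => linearSubst_X_mem_of_rowShear hβ hi
  -- As `β * α` is still in `U`, the leading exponents of its ideal are again `M`; `β` respects low
  -- parts, so the `x^s`-coefficient of the image of `f` is the image of that of `f`.
  have hmemE : s + Finsupp.single p E ∈ M := by
    have hβf : linearSubst β f ∈ P.map (linearSubst (β * α)) := by
      rw [linearSubst_mul, ← Ideal.map_mapₐ]
      exact Ideal.mem_map_of_mem _ hfQ
    have hβ0 : linearSubst β f ≠ 0 := (map_ne_zero_iff _ (linearSubstEquiv β).injective).2 hf0
    have h2 := (h.degree_eq_add (hM _ hβα) (map_mem_lowSupported hlt hge hf) hβf hβ0).2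
    rw [map_divMonomial hlt hge h.lowPart_eq, hdegβ] at h2
    rw [← h2, ← hM _ hβα]
    exact ⟨_, hβf, hβ0, rfl⟩
  have hlowE : lowPart p.val (s + Finsupp.single p E) ∉ M := by
    have : lowPart p.val (Finsupp.single p E) = 0 :=
      lowPart_eq_zero_iff.2 fun i hi => Finsupp.single_eq_of_ne (ne_of_lt (Fin.lt_def.2 hi))
    rw [lowPart_add, this, add_zero, h.lowPart_eq]
    exact h.notMem
  -- The leading monomial of `g` divides `x_p^E`, so it is itself a power of `x_p`.
  have hle := le_of_add_le_add_left (hmin _ hmemE hlowE)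
  have hsingle : (degRevLex n).degree (f.divMonomial s) =
      Finsupp.single p ((degRevLex n).degree (f.divMonomial s) p) := by
    ext i
    rcases eq_or_ne i p with rfl | hi
    · simp
    · have := hle i
      rw [Finsupp.single_eq_of_ne hi] at this ⊢
      omega
  refine ⟨_, Nat.pos_of_ne_zero fun h0 => ?_, hsingle ▸ hmem, hsingle ▸ hmin⟩
  rw [hsingle, h0, Finsupp.single_zero, add_zero] at hmem
  exact h.notMem hmem

end ExtraGenerator

/-! ### Translating the hypotheses on `Π_r(J)` and `Φ_r(J)` into exponents. -/

section Projection

variable {k : Type*} [Field k] {n r : ℕ}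

theorem projVars_rename (hrn : r ≤ n) (f : MvPolynomial (Fin r) k) :
    projVars k n r (rename (Fin.castLE hrn) f) = f := by
  have : (projVars k n r).comp (rename (Fin.castLE hrn)) = AlgHom.id k _ := by
    ext1 i
    simp [projVars]
  exact DFunLike.congr_fun this f

theorem rename_projVars_X (hrn : r ≤ n) (i : Fin n) :
    rename (Fin.castLE hrn) (projVars k n r (X i)) = if i.val < r then X i else 0 := by
  rw [projVars, aeval_X]
  split_ifs
  · rw [rename_X]
    rfl
  · exact map_zero _

theorem rename_projVars_monomial (hrn : r ≤ n) {c : Fin n →₀ ℕ} (hc : lowPart r c = c) :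
    rename (Fin.castLE hrn) (projVars k n r (monomial c 1)) = monomial c 1 :=
  map_monomial_of_fixes_low (φ := (rename (Fin.castLE hrn)).comp (projVars k n r))
    (fun i hi => by rw [AlgHom.comp_apply, rename_projVars_X, if_pos hi]) hc

/-- Monomial ideals are stable under killing the last variables. -/
theorem rename_mem_of_mem_map_projVars (hrn : r ≤ n) {T : Set (Fin n →₀ ℕ)}
    {f : MvPolynomial (Fin r) k}
    (hf : f ∈ (Ideal.span ((fun c => monomial c (1 : k)) '' T)).map (projVars k n r)) :
    rename (Fin.castLE hrn) f ∈ Ideal.span ((fun c => monomial c (1 : k)) '' T) := by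
  suffices h : (Ideal.span ((fun c => monomial c (1 : k)) '' T)).map (projVars k n r) ≤
      (Ideal.span ((fun c => monomial c (1 : k)) '' T)).comap (rename (Fin.castLE hrn)) from h hf
  rw [Ideal.map_le_iff_le_comap, Ideal.span_le]
  rintro _ ⟨c, hc, rfl⟩
  change rename (Fin.castLE hrn) (projVars k n r (monomial c 1)) ∈
    Ideal.span ((fun c => monomial c (1 : k)) '' T)
  by_cases hlow : lowPart r c = c
  · rw [rename_projVars_monomial hrn hlow]
    exact Ideal.subset_span ⟨c, hc, rfl⟩
  · rw [lowPart_eq_self_iff] at hlow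
    push Not at hlow
    obtain ⟨i, hi, hci⟩ := hlow
    have : monomial c (1 : k) = monomial (c - Finsupp.single i 1) 1 * X i := by
      rw [X, monomial_mul, tsub_add_cancel_of_le, one_mul]
      rw [Finsupp.single_le_iff]
      omega
    rw [this, map_mul, map_mul, rename_projVars_X, if_neg (by omega), mul_zero]
    exact zero_mem _

theorem span_monomial_sup_span_singleton (T : Set (Fin n →₀ ℕ)) (b : Fin n →₀ ℕ) :
    Ideal.span ((fun c => monomial c (1 : k)) '' T) ⊔ Ideal.span {monomial b 1} =
      Ideal.span ((fun c => monomial c (1 : k)) '' (T ∪ {b})) := by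
  rw [Set.image_union, Ideal.span_union, Set.image_singleton]

theorem contractExtend_eq_span {M : Set (Fin n →₀ ℕ)} (hM : IsUpperSet M) :
    contractExtend r (Ideal.span ((fun c => monomial c (1 : k)) '' M)) =
      Ideal.span ((fun c => monomial c (1 : k)) '' {c | c ∈ M ∧ lowPart r c = c}) := by
  classical
  refine le_antisymm (Ideal.span_le.2 ?_) (Ideal.span_mono ?_)
  · rintro f ⟨hf, hsupp⟩
    rw [mem_ideal_span_monomial_image] at hf
    refine mem_ideal_span_monomial_image.2 fun c hc => ⟨c, ⟨?_, ?_⟩, le_rfl⟩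
    · obtain ⟨t, ht, htc⟩ := hf c hc
      exact hM htc ht
    · refine lowPart_eq_self_iff.2 fun i hi => ?_
      by_contra hci
      have : i.val < r :=
        mem_supported.1 hsupp ((mem_vars_iff_mem_support i).2 ⟨c, hc, Finsupp.mem_support_iff.2 hci⟩)
      omega
  · rintro _ ⟨c, ⟨hc, hlow⟩, rfl⟩
    refine ⟨Ideal.subset_span ⟨c, hc, rfl⟩, mem_supported.2 ?_⟩
    rw [vars_monomial one_ne_zero]
    intro i hi
    by_contra h
    exact Finsupp.mem_support_iff.1 hi (lowPart_eq_self_iff.1 hlow i (not_lt.1 h))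

theorem monomial_mem_contractExtend_iff {M : Set (Fin n →₀ ℕ)} (hM : IsUpperSet M)
    {c : Fin n →₀ ℕ} :
    monomial c 1 ∈ contractExtend r (Ideal.span ((fun c => monomial c (1 : k)) '' M)) ↔
      lowPart r c ∈ M := by
  rw [contractExtend_eq_span hM, monomial_mem_span_monomial_iff]
  constructor
  · rintro ⟨t, ⟨ht, hlow⟩, htc⟩
    exact hM (hlow ▸ lowPart_mono r htc) ht
  · intro h
    exact ⟨_, ⟨h, lowPart_lowPart r c⟩, lowPart_le r c⟩

theorem lowPart_mapDomain_castLE (hrn : r ≤ n) (a : Fin r →₀ ℕ) :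
    lowPart r (a.mapDomain (Fin.castLE hrn)) = a.mapDomain (Fin.castLE hrn) := by
  refine lowPart_eq_self_iff.2 fun i hi => Finsupp.mapDomain_of_notMem_range _ _ ?_
  rintro ⟨j, rfl⟩
  simp at hi
  omega

/-- The hypotheses on `Π_r(J)` and `Φ_r(J)`, for a monomial ideal `J`, in terms of exponents. -/
theorem isSocleShape_of_phiBar_eq (hrn : r ≤ n) {M : Set (Fin n →₀ ℕ)} (hM : IsUpperSet M)
    {J : Ideal (MvPolynomial (Fin n) k)}
    (hJ : J = Ideal.span ((fun c => monomial c (1 : k)) '' M)) (a : Fin r →₀ ℕ)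
    (hcolon : monomial a 1 ∈ (J.map (projVars k n r)).colon (maxHomogeneousIdeal k r))
    (hnot : monomial a 1 ∉ J.map (projVars k n r))
    (hPhi : PhiBar r J = J.map (projVars k n r) ⊔ Ideal.span {monomial a 1}) :
    IsSocleShape r M (a.mapDomain (Fin.castLE hrn)) := by
  set s := a.mapDomain (Fin.castLE hrn) with hs
  have hslow : lowPart r s = s := lowPart_mapDomain_castLE hrn a
  have hmemJ : ∀ c, monomial c (1 : k) ∈ J ↔ c ∈ M := by
    intro c
    rw [hJ, monomial_mem_span_monomial_iff]
    exact ⟨fun ⟨t, ht, htc⟩ => hM htc ht, fun h => ⟨c, h, le_rfl⟩⟩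
  have hren : rename (Fin.castLE hrn) (monomial a (1 : k)) = monomial s 1 := rename_monomial _ _ _
  have hproj : projVars k n r (monomial s 1) = monomial a 1 := by
    rw [← hren, projVars_rename]
  have hsM : s ∉ M := fun h => hnot (hproj ▸ Ideal.mem_map_of_mem _ ((hmemJ s).2 h))
  have hadd : ∀ i : Fin n, i.val < r → s + Finsupp.single i 1 ∈ M := by
    intro i hi
    have h1 := Submodule.mem_colon.1 hcolon (X ⟨i.val, hi⟩)
      (Ideal.subset_span (Set.mem_range_self _))
    rw [hJ] at h1
    have h2 := rename_mem_of_mem_map_projVars hrn h1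
    rw [smul_eq_mul, map_mul, hren, rename_X, X, monomial_mul, one_mul, ← hJ, hmemJ] at h2
    exact h2
  -- A proper low multiple of `x^s` is divisible by some `x^s x_i` with `x_i` low, hence lies in
  -- `M`.
  have hgt : ∀ c, lowPart r c = c → s ≤ c → c ∈ M ∨ c = s := by
    intro c hc hsc
    by_cases hcs : c = s
    · exact Or.inr hcs
    obtain ⟨i, hi⟩ : ∃ i, c i ≠ s i := by
      by_contra! hall
      exact hcs (Finsupp.ext hall)
    have hir : i.val < r := by
      by_contra hir
      rw [lowPart_eq_self_iff.1 hc i (by omega), lowPart_eq_self_iff.1 hslow i (by omega)] at hi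
      exact hi rfl
    refine Or.inl (hM (fun j => ?_) (hadd i hir))
    have := hsc j
    rcases eq_or_ne j i with rfl | hj
    · rw [Finsupp.add_apply, Finsupp.single_eq_same]
      omega
    · rw [Finsupp.add_apply, Finsupp.single_eq_of_ne hj]
      omega
  have hPhi_eq : Phi r J =
      Ideal.span ((fun c => monomial c (1 : k)) '' (lowPart r '' minimalMonomials J)) := by
    rw [Set.image_image]
    rfl
  have hmin : ∀ c ∈ minimalMonomials J, lowPart r c ∈ M ∨ lowPart r c = s := by
    intro c hc
    have h1 : projVars k n r (monomial (lowPart r c) 1) ∈ PhiBar r J := by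
      refine Ideal.mem_map_of_mem _ ?_
      rw [hPhi_eq]
      exact Ideal.subset_span ⟨_, ⟨c, hc, rfl⟩, rfl⟩
    -- Write the right-hand side as the image under `Π_r` of one monomial ideal of `S`, so that
    -- membership can be pulled back along the inclusion of the low variables.
    rw [hPhi, ← hproj, ← Set.image_singleton, ← Ideal.map_span, ← Ideal.map_sup, hJ,
      span_monomial_sup_span_singleton] at h1
    have h2 := rename_mem_of_mem_map_projVars hrn h1
    rw [rename_projVars_monomial hrn (lowPart_lowPart r c), monomial_mem_span_monomial_iff] at h2
    obtain ⟨t, ht | rfl, htc⟩ := h2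
    · exact Or.inl (hM htc ht)
    · exact hgt _ (lowPart_lowPart r c) htc
  refine ⟨hM, hslow, hsM, hadd, fun c hc => ?_, ?_⟩
  · obtain ⟨b, hbc, hb⟩ := exists_minimal_le_of_wellFoundedLT
      (fun b => monomial b (1 : k) ∈ J) c ((hmemJ c).2 hc)
    rcases hmin b hb with h | h
    · exact Or.inl (hM (lowPart_mono r hbc) h)
    · exact hgt _ (lowPart_lowPart r c) (h ▸ lowPart_mono r hbc)
  · have h1 : monomial a 1 ∈ (Phi r J).map (projVars k n r) := by
      change _ ∈ PhiBar r J
      rw [hPhi]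
      exact Ideal.mem_sup_right (Ideal.mem_span_singleton_self _)
    rw [hPhi_eq] at h1
    have h2 := rename_mem_of_mem_map_projVars hrn h1
    rw [hren, monomial_mem_span_monomial_iff] at h2
    obtain ⟨_, ⟨c, hc, rfl⟩, hcs⟩ := h2
    refine ⟨c, (hmemJ c).1 hc.1, (hmin c hc).resolve_left fun h => hsM (hM hcs h)⟩

end Projection

/-! ### The theorem. -/

/-- Variables are indexed from `0`, so `x_i` is `X (i - 1)`; in particular `x_{r+1}` is
`X ⟨r, hrn⟩`, and `u` is the monomial of `k[x₁,…,x_r]` with exponent vector `a`. -/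
theorem theorem4p2 {k : Type*} [Field k] [Infinite k] {n r : ℕ} (hr : 1 ≤ r) (hrn : r < n)
    (P : Ideal (MvPolynomial (Fin n) k)) (hP : P.IsPrime)
    (hhom : P.IsHomogeneous (homogeneousSubmodule (Fin n) k))
    (J : Ideal (MvPolynomial (Fin n) k)) (hJ : IsGenericInitialIdeal P J)
    (u : MvPolynomial (Fin r) k) (a : Fin r →₀ ℕ) (hu : u = monomial a 1)
    (hcolon : u ∈ (J.map (projVars k n r)).colon (maxHomogeneousIdeal k r))
    (hnot : u ∉ J.map (projVars k n r))
    (hPhi : PhiBar r J = J.map (projVars k n r) ⊔ Ideal.span {u}) :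
    ((u = 1 ∧ ∀ i : Fin n, i.val < r → X i ∈ J) ∨ ∃ b, IsExtraGenerator r J b) ∧
    (u ≠ 1 → ∀ b, IsExtraGenerator r J b →
      ∃ e : ℕ, 0 < e ∧ monomial b 1 = rename (Fin.castLE hrn.le) u * X ⟨r, hrn⟩ ^ e) ∧
    (u ≠ 1 → ∃ B : Set (Fin n →₀ ℕ), (∀ b ∈ B, ∀ j : Fin n, r < j.val → b j = 0) ∧
      J = Ideal.span ((fun b => monomial b 1) '' B)) := by
  obtain ⟨U, hU, hUne, hUJ⟩ := hJ
  let M : Set (Fin n →₀ ℕ) := {c | monomial c 1 ∈ J}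
  have hlead : ∀ α ∈ U, leadingExponents (degRevLex n) (P.map (linearSubst α)) = M := by
    intro α hα
    ext c
    rw [← monomial_mem_initialIdeal_iff, hUJ α hα]
    rfl
  have hMJ : J = Ideal.span ((fun c => monomial c (1 : k)) '' M) := by
    obtain ⟨α, hα⟩ := hUne
    rw [← hlead α hα, ← initialIdeal_eq_span, hUJ α hα]
  have hMup : IsUpperSet M := by
    obtain ⟨α, hα⟩ := hUne
    rw [← hlead α hα]
    exact isUpperSet_leadingExponents _ _
  subst hu
  have hshape := isSocleShape_of_phiBar_eq hrn.le hMup hMJ a hcolon hnot hPhi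
  have hren : rename (Fin.castLE hrn.le) (monomial a (1 : k)) =
    monomial (a.mapDomain (Fin.castLE hrn.le)) 1 := rename_monomial _ _ _
  set s := a.mapDomain (Fin.castLE hrn.le) with hs
  have hcontract : ∀ c, monomial c 1 ∈ contractExtend r J ↔ lowPart r c ∈ M := by
    intro c
    rw [hMJ]
    exact monomial_mem_contractExtend_iff hMup
  have hcontract_eq : contractExtend r J =
      Ideal.span ((fun c => monomial c (1 : k)) '' {c | c ∈ M ∧ lowPart r c = c}) := by
    rw [hMJ]
    exact contractExtend_eq_span hMup
  have hmain : monomial a (1 : k) ≠ 1 → ∃ e : ℕ, 0 < e ∧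
      lowPart r (s + Finsupp.single ⟨r, hrn⟩ e) ∉ M ∧
      s + Finsupp.single ⟨r, hrn⟩ e ∈ M ∧
      (∀ c ∈ M, lowPart r c ∉ M → s + Finsupp.single ⟨r, hrn⟩ e ≤ c) ∧
      J = Ideal.span ((fun c => monomial c (1 : k)) ''
        ({c | c ∈ M ∧ lowPart r c = c} ∪ {s + Finsupp.single ⟨r, hrn⟩ e})) := by
    intro hu1
    have hs0 : s ≠ 0 := by
      intro h0
      have : a = 0 := Finsupp.mapDomain_injective (Fin.castLE_injective hrn.le)
        (h0.trans Finsupp.mapDomain_zero.symm)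
      exact hu1 (by rw [this]; rfl)
    obtain ⟨e, he, hmem, hmin⟩ :=
      IsSocleShape.exists_add_single (p := ⟨r, hrn⟩) hshape hs0 hP hU hUne hlead
    have hlow : lowPart r (Finsupp.single (⟨r, hrn⟩ : Fin n) e) = 0 :=
      lowPart_eq_zero_iff.2 fun i hi => Finsupp.single_eq_of_ne (ne_of_lt (Fin.lt_def.2 hi))
    refine ⟨e, he, ?_, hmem, hmin, le_antisymm ?_ ?_⟩
    · rw [lowPart_add, hlow, add_zero, hshape.lowPart_eq]
      exact hshape.notMem
    · conv_lhs => rw [hMJ]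
      rw [Ideal.span_le]
      rintro _ ⟨c, hc, rfl⟩
      rw [SetLike.mem_coe, monomial_mem_span_monomial_iff]
      by_cases hcl : lowPart r c ∈ M
      · exact ⟨_, Or.inl ⟨hcl, lowPart_lowPart r c⟩, lowPart_le r c⟩
      · exact ⟨_, Or.inr rfl, hmin c hc hcl⟩
    · rw [Ideal.span_le]
      rintro _ ⟨c, ⟨hc, -⟩ | rfl, rfl⟩
      · exact hc
      · exact hmem
  refine ⟨?_, ?_, ?_⟩
  · by_cases hu1 : monomial a (1 : k) = 1
    · refine Or.inl ⟨hu1, fun i hi => ?_⟩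
      have hs0 : monomial s (1 : k) = 1 := by rw [← hren, hu1, map_one]
      have : monomial (s + Finsupp.single i 1) (1 : k) ∈ J := hshape.add_single_mem i hi
      rwa [← one_mul (1 : k), ← monomial_mul, hs0, one_mul] at this
    · obtain ⟨e, -, hlow, -, -, hgen⟩ := hmain hu1
      refine Or.inr ⟨_, ?_, mt (hcontract _).1 hlow⟩
      rw [hcontract_eq, span_monomial_sup_span_singleton]
      exact hgen
  · rintro hu1 b ⟨hb, hb'⟩
    obtain ⟨e, he, hlow, hmem, hmin, -⟩ := hmain hu1
    have hbM : b ∈ M := by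
      change monomial b 1 ∈ J
      rw [hb]
      exact Ideal.mem_sup_right (Ideal.mem_span_singleton_self _)
    have hle := hmin b hbM (mt (hcontract b).2 hb')
    -- The monomial `x^s x_{r+1}^e` is in `J` but its low part is not, so only the generator `x^b`
    -- can divide it; with `hle` this gives equality.
    have hge : b ≤ s + Finsupp.single ⟨r, hrn⟩ e := by
      have h1 : monomial (s + Finsupp.single ⟨r, hrn⟩ e) (1 : k) ∈ J := hmem
      rw [hb, hcontract_eq, span_monomial_sup_span_singleton,
        monomial_mem_span_monomial_iff] at h1
      obtain ⟨t, ⟨ht, htl⟩ | rfl, hts⟩ := h1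
      · exact absurd (hMup (htl ▸ lowPart_mono r hts) ht) hlow
      · exact hts
    refine ⟨e, he, ?_⟩
    rw [hren, X_pow_eq_monomial, monomial_mul, one_mul, le_antisymm hge hle]
  · intro hu1
    obtain ⟨e, -, -, -, -, hgen⟩ := hmain hu1
    refine ⟨_, ?_, hgen⟩
    rintro b (⟨-, hb⟩ | rfl) j hj
    · exact lowPart_eq_self_iff.1 hb j hj.le
    · rw [Finsupp.add_apply, lowPart_eq_self_iff.1 hshape.lowPart_eq j hj.le,
        Finsupp.single_eq_of_ne (Fin.ne_of_gt (Fin.lt_def.2 hj)), add_zero]
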